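/- Let $S\subseteq T$ be a finite extension of discrete valuation rings with fraction fields $K\subseteq L$, and assume that $L/K$ is Galois with (finite) group $G$. Let $t$ be a generator of the maximal ideal of $T$, let $v_t$ be the corresponding valuation, and assume that $T=S[\theta]$ for some $\theta\in T$. The group $G$ acts on $T$ by restriction; write $x^\sigma$ for the image of $x\in T$ under $\sigma\in G$. For $\sigma\in G$ let $T_\sigma$ denote $T$ viewed as a $T\otimes_S T$-module (i.e. as a $T$-$T$-bimodule) via $(x\otimes y)\cdot z:=x\,z\,y^{\sigma}$, so that $T_1$ is $T$ with its usual bimodule structure. For a $T\otimes_S T$-module $M$ let $$H_j(T,M;S):=\operatorname{Tor}_j^{T\otimes_S T}(M,T_1),\qquad H^j(T,M;S):=\operatorname{Ext}^j_{T\otimes_S T}(T_1,M)\qquad (j\ge 0)$$ be the Hochschild homology and cohomology of $T$ over $S$ with coefficients in $M$. Put $\phi:=\sum_{\sigma\in G\setminus\{1\}}v_t(\theta-\theta^\sigma)$. Then there are isomorphisms of $T\otimes_S T$-modules as follows, where quotients of $T$ in the formulas for $T_\sigma$ are regarded as quotients of $T_\sigma$. (a) Homology, untwisted coefficients: $$H_j(T,T_1;S)\cong\begin{cases}T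 & j=0\\ T/t^{\phi}T & j\text{ odd}\\ 0 & j\text{ even},\ j\ge 2.\end{cases}$$ (b) Homology, twisted coefficients: for every $\sigma\in G\setminus\{1\}$, $$H_j(T,T_\sigma;S)\cong\begin{cases}0 & j\text{ odd}\\ T/(\theta^{\sigma}-\theta)T & j\text{ even}.\end{cases}$$ (c) Cohomology, untwisted coefficients: $$H^j(T,T_1;S)\cong\begin{cases}T & j=0\\ 0 & j\text{ odd}\\ T/t^{\phi}T & j\text{ even},\ j\ge 2.\end{cases}$$ (d) Cohomology, twisted coefficients: for every $\sigma\in G\setminus\{1\}$, $$H^j(T,T_\sigma;S)\cong\begin{cases}T/(\theta^{\sigma}-\theta)T & j\text{ odd}\\ 0 & j\text{ even}.\end{cases}$$ -/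

import Mathlib

open CategoryTheory
open scoped TensorProduct

noncomputable section

namespace TwistedHochschild

universe v u w₁ w₂

section Bimodules

variable {S : Type v} {T : Type u} [CommRing S] [CommRing T] [Algebra S T]

/-- The ring morphism `T ⊗[S] T → T`, `x ⊗ y ↦ x * σ y`. -/
def twist (σ : T ≃ₐ[S] T) : T ⊗[S] T →ₐ[S] T :=
  Algebra.TensorProduct.productMap (AlgHom.id S T) (σ : T →ₐ[S] T)

theorem twist_tmul (σ : T ≃ₐ[S] T) (x y : T) : twist σ (x ⊗ₜ[S] y) = x * σ y := by
  simp [twist]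

/-- The `T`-module `N`, viewed as an `S`-central `T`-`T`-bimodule with untwisted left
multiplication and `σ`-twisted right multiplication, that is, as a module over `T ⊗[S] T` (which is
the enveloping algebra of the commutative `S`-algebra `T`) with
`(x ⊗ y) • z = (x * σ y) • z`. -/
def twisted (σ : T ≃ₐ[S] T) (N : Type u) [AddCommGroup N] [Module T N] :
    ModuleCat.{u} (T ⊗[S] T) :=
  (ModuleCat.restrictScalars (twist σ : T ⊗[S] T →+* T)).obj (ModuleCat.of T N)

variable (S T) in
/-- The Hochschild homology `H_j(T, M; S) = Tor_j^{T ⊗[S] T}(M, T)` of `T` over the ground ring `S`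
with coefficients in the bimodule `M`, where the second `T` is the untwisted bimodule. -/
def hochschildHomology (M : ModuleCat.{u} (T ⊗[S] T)) (j : ℕ) : ModuleCat.{u} (T ⊗[S] T) :=
  ((Tor (ModuleCat.{u} (T ⊗[S] T)) j).obj M).obj (twisted AlgEquiv.refl T)

variable (S T) in
/-- The Hochschild cohomology `H^j(T, M; S) = Ext^j_{T ⊗[S] T}(T, M)` of `T` over the ground ring
`S` with coefficients in the bimodule `M`, where `T` is the untwisted bimodule. -/
def hochschildCohomology (M : ModuleCat.{u} (T ⊗[S] T)) (j : ℕ) : ModuleCat.{u} (T ⊗[S] T) :=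
  ((_root_.Ext (T ⊗[S] T) (ModuleCat.{u} (T ⊗[S] T)) j).obj
    (Opposite.op (twisted AlgEquiv.refl T))).obj M

end Bimodules

section Galois

variable (S : Type v) {T : Type u} (K : Type w₁) (L : Type w₂)
  [CommRing S] [CommRing T] [IsDomain T] [IsDiscreteValuationRing T]
  [Algebra S T] [Module.Finite S T] [Field K] [Field L]
  [Algebra S K] [IsFractionRing S K] [Algebra T L] [IsFractionRing T L]
  [Algebra K L] [Algebra S L] [IsScalarTower S K L] [IsScalarTower S T L]
  [FiniteDimensional K L]

/-- The exponent `φ = ∑_{σ ≠ 1} v_t(θ - θ^σ)`, where `σ` runs over the Galois group of `L` over `K`,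
which acts on `T` by restriction, and where `v_t` is the `t`-adic valuation. (The sum is finite, and
`θ ≠ θ^σ` for `σ ≠ 1` when `T = S[θ]`.) -/
def phi (t θ : T) : ℕ :=
  ∑ᶠ (σ : L ≃ₐ[K] L) (_ : σ ≠ 1), multiplicity t (θ - galRestrict S K L T σ θ)

end Galois

end TwistedHochschild

end

open TwistedHochschild

namespace TwistedHochschild

open Limits

universe u

/-! ### Homology at a spot where one differential is injective or zero. -/

section Homology

variable {R : Type u} [Ring R] {c : ComplexShape ℕ} (K : HomologicalComplex (ModuleCat.{u} R) c)

/-! Write `R = T ⊗[S] T`. Because `T = S[θ]`, sending `X` to `1 ⊗ θ` presents `R` as `T[X] / (F)`,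
where `F = ∏ (X - θ^σ)` over all `σ` in the Galois group; `F` is the minimal polynomial of `θ` over
`S` (`map_minpoly_eq_prod`, `evalRight_eq_zero_iff`). Split `F = (X - θ) g`, and let `a`, `b` be the
images of `X - θ` and `g` in `R`. Since `T[X]` is a domain, cancellation shows that the annihilator
of each of `a`, `b` is generated by the other, and `R / (a)` is the untwisted bimodule `T` by
evaluation at `θ`. Hence `T` has the 2-periodic free resolution with differentials `a, b, a, b, …`
(`twistedPresentation`).

Tensoring it with `T_σ`, or mapping it into `T_σ`, leaves copies of `T` with differentials
alternately multiplication by `θ^σ - θ` and by `g(θ^σ)` (`torIso`, `extIso`, `twist_evalRight`). For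
`σ = 1` the first is zero and the second is `∏ (θ - θ^τ)` over `τ ≠ 1`, a unit times `t ^ φ`
(`associated_eval_cofactor`). For `σ ≠ 1` the first is nonzero and the second is zero. As `T` is a
domain, a nonzero multiplier is injective, so each homology module can be read off as zero, `T`, or
a quotient of `T`. -/

theorem isZero_homology_of_injective {j : ℕ} (hK : Function.Injective (K.d j (c.next j))) :
    IsZero (K.homology j) := by
  refine (K.sc j).exact_iff_isZero_homology.1 ((ShortComplex.moduleCat_exact_iff _).2 fun x hx => ?_)
  exact ⟨0, by rw [map_zero]; exact (hK (hx.trans (map_zero _).symm)).symm⟩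

/-- If the differential out of degree `j` vanishes, the homology in degree `j` is the cokernel of
the differential into degree `j`. -/
theorem nonempty_homology_iso {j : ℕ} (hK : K.d j (c.next j) = 0) {Q : ModuleCat.{u} R}
    (q : K.X j ⟶ Q) (hq : Function.Surjective q)
    (hq' : ∀ x, q x = 0 ↔ ∃ y, K.d (c.prev j) j y = x) :
    Nonempty (K.homology j ≅ Q) := by
  have : Epi q := (ModuleCat.epi_iff_surjective q).2 hq
  have w : K.d (c.prev j) j ≫ q = 0 := by
    ext y
    exact (hq' _).2 ⟨y, rfl⟩
  have hex : (ShortComplex.mk _ q w).Exact :=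
    (ShortComplex.moduleCat_exact_iff _).2 fun x hx => (hq' x).1 hx
  exact ⟨(ShortComplex.HomologyData.ofIsColimitCokernelCofork (K.sc j) hK (CokernelCofork.ofπ q w)
    hex.gIsCokernel).left.homologyIso⟩

end Homology

/-! ### Two-periodic resolutions, and the Tor and Ext they compute. -/

section Periodic

variable {R : Type u} [CommRing R]

/-- The complex with all terms `M` whose differentials are multiplication by `b` out of even
degrees and by `a` out of odd degrees. -/
noncomputable abbrev periodic {c : ComplexShape ℕ} [DecidableRel c.Rel]
    (hc : ∀ i j, c.Rel i j → Odd (i + j)) (M : ModuleCat.{u} R) (a b : R) (h : a * b = 0) :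
    HomologicalComplex (ModuleCat.{u} R) c :=
  HomologicalComplex.alternatingConst M (φ := b • 𝟙 M) (ψ := a • 𝟙 M)
    (by simp [smul_smul, h]) (by simp [smul_smul, mul_comm b, h]) hc

noncomputable abbrev periodicChain (M : ModuleCat.{u} R) (a b : R) (h : a * b = 0) :
    ChainComplex (ModuleCat.{u} R) ℕ :=
  periodic (fun _ _ => ComplexShape.down_nat_odd_add) M a b h

noncomputable abbrev periodicCochain (M : ModuleCat.{u} R) (a b : R) (h : a * b = 0) :
    CochainComplex (ModuleCat.{u} R) ℕ :=
  periodic (fun _ _ => ComplexShape.up_nat_odd_add) M a b h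

theorem periodicChain_d_of_even {M : ModuleCat.{u} R} {a b : R} (h : a * b = 0) {i j : ℕ}
    (hij : j + 1 = i) (hi : Even i) : (periodicChain M a b h).d i j = b • 𝟙 M := by
  simp [hij, hi]
  rfl

theorem periodicChain_d_of_odd {M : ModuleCat.{u} R} {a b : R} (h : a * b = 0) {i j : ℕ}
    (hij : j + 1 = i) (hi : Odd i) : (periodicChain M a b h).d i j = a • 𝟙 M := by
  simp [hij, Nat.not_even_iff_odd.2 hi]
  rfl

theorem periodicCochain_d_of_even {M : ModuleCat.{u} R} {a b : R} (h : a * b = 0) {i j : ℕ}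
    (hij : i + 1 = j) (hi : Even i) : (periodicCochain M a b h).d i j = b • 𝟙 M := by
  simp [hij, hi]
  rfl

theorem periodicCochain_d_of_odd {M : ModuleCat.{u} R} {a b : R} (h : a * b = 0) {i j : ℕ}
    (hij : i + 1 = j) (hi : Odd i) : (periodicCochain M a b h).d i j = a • 𝟙 M := by
  simp [hij, Nat.not_even_iff_odd.2 hi]
  rfl

theorem smul_id_injective {M : ModuleCat.{u} R} {a : R} (ha : ∀ x : M, a • x = 0 → x = 0) :
    Function.Injective (a • 𝟙 M : M ⟶ M) :=
  (injective_iff_map_eq_zero _).2 fun x hx => ha x hx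

theorem smul_id_eq_zero {M : ModuleCat.{u} R} {a : R} (ha : ∀ x : M, a • x = 0) :
    (a • 𝟙 M : M ⟶ M) = 0 := by
  ext x
  exact ha x

/-- The augmentation of the periodic complex on `R` given by a map out of `R` killing `a`. -/
noncomputable def periodicAugmentation {N : ModuleCat.{u} R} {a b : R} (h : a * b = 0)
    (p : ModuleCat.of R R ⟶ N) (hap : ∀ x : R, p (a * x) = 0) :
    periodicChain (ModuleCat.of R R) a b h ⟶ (ChainComplex.single₀ (ModuleCat.{u} R)).obj N :=
  ((periodicChain (ModuleCat.of R R) a b h).toSingle₀Equiv _).symm ⟨p, by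
    have hd : (a • 𝟙 (ModuleCat.of R R)) ≫ p = 0 := by
      ext
      rw [Linear.smul_comp, Category.id_comp]
      -- Linear maps out of `R` are determined by their value at `1`.
      simpa only [mul_one, ← smul_eq_mul, map_smul] using! hap 1
    simp only [HomologicalComplex.alternatingConst_d]
    exact hd⟩

/-- Surjectivity of `p` and `hap` settle degree `0`. In positive degrees, exactness is `hb` where
the outgoing differential is `b` (even degree) and `ha` where it is `a` (odd degree). -/
theorem quasiIso_periodicAugmentation {N : ModuleCat.{u} R} {a b : R} (h : a * b = 0)
    (p : ModuleCat.of R R ⟶ N) (hp : Function.Surjective p)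
    (hap : ∀ x : R, p x = 0 ↔ ∃ y, x = a * y)
    (ha : ∀ x : R, a * x = 0 → ∃ y, x = b * y) (hb : ∀ x : R, b * x = 0 → ∃ y, x = a * y) :
    QuasiIso (periodicAugmentation h p fun x => (hap _).2 ⟨x, rfl⟩) where
  quasiIsoAt m := by
    cases m with
    | zero =>
      simp only [periodicAugmentation]
      rw [ChainComplex.quasiIsoAt₀_iff, ShortComplex.quasiIso_iff_of_zeros' _ rfl rfl rfl]
      constructor
      · rw [ShortComplex.moduleCat_exact_iff]
        intro x hx
        obtain ⟨y, rfl⟩ := (hap x).1 (by simpa [ChainComplex.toSingle₀Equiv] using! hx)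
        exact ⟨y, by simp; rfl⟩
      · rw [ModuleCat.epi_iff_surjective]
        simpa [ChainComplex.toSingle₀Equiv] using! hp
    | succ m =>
      rw [quasiIsoAt_iff_exactAt' (hL := ChainComplex.exactAt_succ_single_obj ..),
          HomologicalComplex.exactAt_iff' _ (m + 2) (m + 1) m (by simp) (by simp),
          ShortComplex.moduleCat_exact_iff]
      intro x hx
      by_cases hm : Even (m + 1)
      · have hm' : ¬ Even (m + 2) := by grind
        obtain ⟨y, rfl⟩ := hb x (by simpa [hm] using! hx)
        exact ⟨y, by simp [hm']; rfl⟩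
      · have hm' : Even (m + 2) := by grind
        obtain ⟨y, rfl⟩ := ha x (by simpa [hm] using! hx)
        exact ⟨y, by simp [hm']; rfl⟩

/-- The `2`-periodic free resolution of a cyclic module `R ⧸ (a)` attached to an exact pair of
zero divisors `a`, `b`. -/
noncomputable def periodicResolution {N : ModuleCat.{u} R} {a b : R} (h : a * b = 0)
    (p : ModuleCat.of R R ⟶ N) (hp : Function.Surjective p)
    (hap : ∀ x : R, p x = 0 ↔ ∃ y, x = a * y)
    (ha : ∀ x : R, a * x = 0 → ∃ y, x = b * y) (hb : ∀ x : R, b * x = 0 → ∃ y, x = a * y) :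
    ProjectiveResolution N where
  complex := periodicChain (ModuleCat.of R R) a b h
  projective _ := inferInstanceAs <| Projective (ModuleCat.of R R)
  π := periodicAugmentation h p fun x => (hap _).2 ⟨x, rfl⟩
  quasiIso := quasiIso_periodicAugmentation h p hp hap ha hb

open MonoidalCategory in
theorem rightUnitor_naturality_smul (M : ModuleCat.{u} R) (a : R) :
    (ρ_ M).hom ≫ (a • 𝟙 M) = (M ◁ (a • 𝟙 (ModuleCat.of R R))) ≫ (ρ_ M).hom := by
  have : M ◁ (a • 𝟙 (ModuleCat.of R R)) = a • 𝟙 (M ⊗ ModuleCat.of R R) := by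
    rw [MonoidalLinear.whiskerLeft_smul, whiskerLeft_id]
  rw [this, Linear.smul_comp, Linear.comp_smul, Category.comp_id]
  exact congrArg (a • ·) (Category.id_comp _).symm

/-- Morphisms out of the free module of rank one. -/
noncomputable def homRingIso (M : ModuleCat.{u} R) :
    ModuleCat.of R (ModuleCat.of R R ⟶ M) ≅ M :=
  (ModuleCat.homLinearEquiv (S := R) ≪≫ₗ LinearMap.ringLmapEquivSelf R R M).toModuleIso

theorem homRingIso_naturality_smul (M : ModuleCat.{u} R) (a : R) :
    (homRingIso M).hom ≫ (a • 𝟙 M) =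
      ModuleCat.ofHom (Linear.leftComp R M (a • 𝟙 (ModuleCat.of R R))) ≫ (homRingIso M).hom := by
  ext x
  change a • x.hom (1 : R) = ((a • 𝟙 (ModuleCat.of R R)) ≫ x).hom (1 : R)
  rw [Linear.smul_comp, Category.id_comp]
  rfl

open MonoidalCategory in
/-- Tensoring the periodic complex on `R` with `M` gives the periodic complex on `M`. -/
noncomputable def tensorPeriodicIso (M : ModuleCat.{u} R) {a b : R} (h : a * b = 0) :
    (((tensoringLeft (ModuleCat.{u} R)).obj M).mapHomologicalComplex _).obj
      (periodicChain (ModuleCat.of R R) a b h) ≅ periodicChain M a b h :=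
  HomologicalComplex.Hom.isoOfComponents (fun _ => ρ_ M) <| by
    rintro i j ⟨rfl⟩
    by_cases hj : Even (j + 1) <;>
      simp only [HomologicalComplex.alternatingConst_d, Functor.mapHomologicalComplex_obj_d,
        ComplexShape.down_Rel, hj, if_true, if_false]
    · exact rightUnitor_naturality_smul M b
    · exact rightUnitor_naturality_smul M a

/-- Dualising reverses arrows: the map out of degree `i` comes from the chain differential out of `i
+ 1`, of opposite parity. This is why `a` and `b` trade places. -/
noncomputable def homPeriodicIso (M : ModuleCat.{u} R) {a b : R} (h : a * b = 0) :
    (periodicChain (ModuleCat.of R R) a b h).linearYonedaObj R M ≅ periodicCochain M b a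
      (by rw [mul_comm, h]) :=
  HomologicalComplex.Hom.isoOfComponents (fun _ => homRingIso M) <| by
    rintro i j ⟨rfl⟩
    by_cases hj : Even i
    · have hj' : ¬ Even (i + 1) := by grind
      have key := homRingIso_naturality_smul M a
      simp [hj, hj']
      exact key
    · have hj' : Even (i + 1) := by grind
      have key := homRingIso_naturality_smul M b
      simp [hj, hj']
      exact key

/-- A presentation `R ⟶ N` of a cyclic module `N ≅ R ⧸ (a)`, where `a`, `b` is an exact pair of
zero divisors of `R`. -/
structure PeriodicPresentation (N : ModuleCat.{u} R) (a b : R) where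
  map : ModuleCat.of R R ⟶ N
  surjective : Function.Surjective map
  map_eq_zero_iff (x : R) : map x = 0 ↔ ∃ y, x = a * y
  mul_eq_zero : a * b = 0
  exists_of_mul_left (x : R) : a * x = 0 → ∃ y, x = b * y
  exists_of_mul_right (x : R) : b * x = 0 → ∃ y, x = a * y

namespace PeriodicPresentation

variable {N : ModuleCat.{u} R} {a b : R} (p : PeriodicPresentation N a b) (M : ModuleCat.{u} R)

noncomputable def resolution : ProjectiveResolution N :=
  periodicResolution p.mul_eq_zero p.map p.surjective p.map_eq_zero_iff p.exists_of_mul_left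
    p.exists_of_mul_right

noncomputable def torIso (j : ℕ) :
    ((Tor (ModuleCat.{u} R) j).obj M).obj N ≅ (periodicChain M a b p.mul_eq_zero).homology j :=
  p.resolution.isoLeftDerivedObj _ j ≪≫
    (HomologicalComplex.homologyFunctor _ _ j).mapIso (tensorPeriodicIso M p.mul_eq_zero)

noncomputable def extIso (j : ℕ) :
    ((_root_.Ext R (ModuleCat.{u} R) j).obj (Opposite.op N)).obj M ≅
      (periodicCochain M b a (by rw [mul_comm, p.mul_eq_zero])).homology j :=
  p.resolution.isoExt j M ≪≫
    (HomologicalComplex.homologyFunctor _ _ j).mapIso (homPeriodicIso M p.mul_eq_zero)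

variable {M}

include p in
theorem isZero_tor_of_odd (ha : ∀ x : M, a • x = 0 → x = 0) {j : ℕ} (hj : Odd j) :
    IsZero (((Tor (ModuleCat.{u} R) j).obj M).obj N) := by
  refine IsZero.of_iso (isZero_homology_of_injective _ ?_) (p.torIso M j)
  have hj' := hj
  obtain ⟨i, rfl⟩ := hj'
  rw [periodicChain_d_of_odd _ (by simp) hj]
  exact smul_id_injective ha

include p in
theorem isZero_tor_of_even (hb : ∀ x : M, b • x = 0 → x = 0) {j : ℕ} (hj : Even j) (hj₀ : j ≠ 0) :
    IsZero (((Tor (ModuleCat.{u} R) j).obj M).obj N) := by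
  refine IsZero.of_iso (isZero_homology_of_injective _ ?_) (p.torIso M j)
  obtain ⟨i, rfl⟩ := Nat.exists_eq_succ_of_ne_zero hj₀
  rw [periodicChain_d_of_even _ (by simp) hj]
  exact smul_id_injective hb

include p in
theorem isZero_ext_of_even (ha : ∀ x : M, a • x = 0 → x = 0) {j : ℕ} (hj : Even j) :
    IsZero (((_root_.Ext R (ModuleCat.{u} R) j).obj (Opposite.op N)).obj M) := by
  refine IsZero.of_iso (isZero_homology_of_injective _ ?_) (p.extIso M j)
  rw [periodicCochain_d_of_even _ (by simp) hj]
  exact smul_id_injective ha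

include p in
theorem isZero_ext_of_odd (hb : ∀ x : M, b • x = 0 → x = 0) {j : ℕ} (hj : Odd j) :
    IsZero (((_root_.Ext R (ModuleCat.{u} R) j).obj (Opposite.op N)).obj M) := by
  refine IsZero.of_iso (isZero_homology_of_injective _ ?_) (p.extIso M j)
  rw [periodicCochain_d_of_odd _ (by simp) hj]
  exact smul_id_injective hb

variable {Q : ModuleCat.{u} R} (q : M ⟶ Q) (hq : Function.Surjective q)

include p hq in
theorem nonempty_tor_iso_of_odd (ha : ∀ x : M, a • x = 0)
    (hqb : ∀ x, q x = 0 ↔ ∃ y : M, b • y = x) {j : ℕ} (hj : Odd j) :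
    Nonempty (((Tor (ModuleCat.{u} R) j).obj M).obj N ≅ Q) := by
  have hd : (periodicChain M a b p.mul_eq_zero).d j ((ComplexShape.down ℕ).next j) = 0 := by
    have hj' := hj
    obtain ⟨i, rfl⟩ := hj'
    rw [periodicChain_d_of_odd _ (by simp) hj]
    exact smul_id_eq_zero ha
  refine (nonempty_homology_iso _ hd q hq ?_).map (p.torIso M j ≪≫ ·)
  rw [periodicChain_d_of_even _ (by simp) (by simp; grind)]
  exact hqb

include p hq in
theorem nonempty_tor_iso_of_even {j : ℕ} (hj : Even j) (hb : j ≠ 0 → ∀ x : M, b • x = 0)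
    (hqa : ∀ x, q x = 0 ↔ ∃ y : M, a • y = x) :
    Nonempty (((Tor (ModuleCat.{u} R) j).obj M).obj N ≅ Q) := by
  have hd : (periodicChain M a b p.mul_eq_zero).d j ((ComplexShape.down ℕ).next j) = 0 := by
    -- In degree `0` nothing leaves the chain complex, so no condition on `b` is needed there.
    rcases eq_or_ne j 0 with rfl | hj₀
    · exact HomologicalComplex.shape _ _ _ (by simp)
    · specialize hb hj₀
      obtain ⟨i, rfl⟩ := Nat.exists_eq_succ_of_ne_zero hj₀
      rw [periodicChain_d_of_even _ (by simp) hj]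
      exact smul_id_eq_zero hb
  refine (nonempty_homology_iso _ hd q hq ?_).map (p.torIso M j ≪≫ ·)
  rw [periodicChain_d_of_odd _ (by simp) (by simp; grind)]
  exact hqa

include p hq in
theorem nonempty_ext_iso_of_odd (hb : ∀ x : M, b • x = 0)
    (hqa : ∀ x, q x = 0 ↔ ∃ y : M, a • y = x) {j : ℕ} (hj : Odd j) :
    Nonempty (((_root_.Ext R (ModuleCat.{u} R) j).obj (Opposite.op N)).obj M ≅ Q) := by
  have hd : (periodicCochain M b a (by rw [mul_comm, p.mul_eq_zero])).d j
      ((ComplexShape.up ℕ).next j) = 0 := by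
    rw [periodicCochain_d_of_odd _ (by simp) hj]
    exact smul_id_eq_zero hb
  refine (nonempty_homology_iso _ hd q hq ?_).map (p.extIso M j ≪≫ ·)
  obtain ⟨i, rfl⟩ := hj
  rw [periodicCochain_d_of_even _ (by simp) (by simp)]
  exact hqa

include p hq in
theorem nonempty_ext_iso_of_even (ha : ∀ x : M, a • x = 0)
    (hqb : ∀ x, q x = 0 ↔ ∃ y : M, b • y = x) {j : ℕ} (hj : Even j) (hj₀ : j ≠ 0) :
    Nonempty (((_root_.Ext R (ModuleCat.{u} R) j).obj (Opposite.op N)).obj M ≅ Q) := by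
  have hd : (periodicCochain M b a (by rw [mul_comm, p.mul_eq_zero])).d j
      ((ComplexShape.up ℕ).next j) = 0 := by
    rw [periodicCochain_d_of_even _ (by simp) hj]
    exact smul_id_eq_zero ha
  refine (nonempty_homology_iso _ hd q hq ?_).map (p.extIso M j ≪≫ ·)
  obtain ⟨i, rfl⟩ := Nat.exists_eq_succ_of_ne_zero hj₀
  rw [periodicCochain_d_of_odd _ (by simp) (by simp; grind)]
  exact hqb

include p in
theorem nonempty_ext_zero_iso (ha : ∀ x : M, a • x = 0) :
    Nonempty (((_root_.Ext R (ModuleCat.{u} R) 0).obj (Opposite.op N)).obj M ≅ M) := by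
  have hd : (periodicCochain M b a (by rw [mul_comm, p.mul_eq_zero])).d 0
      ((ComplexShape.up ℕ).next 0) = 0 := by
    rw [periodicCochain_d_of_even _ (by simp) (by simp)]
    exact smul_id_eq_zero ha
  refine (nonempty_homology_iso _ hd (𝟙 M) Function.surjective_id ?_).map (p.extIso M 0 ≪≫ ·)
  -- No differential enters degree `0`, so the cokernel is all of `M`.
  rw [HomologicalComplex.shape _ _ _ (by simp)]
  exact fun x => ⟨fun hx => ⟨0, hx.symm⟩, fun ⟨_, hy⟩ => hy.symm⟩

end PeriodicPresentation

end Periodic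

end TwistedHochschild

/-! ### The enveloping algebra as a quotient of `T[X]`. -/

namespace TwistedHochschild
open Polynomial

/-- Distinct roots form a multiset without repetition, so being contained in the roots of `f`
already bounds it by them with multiplicity. -/
theorem prod_X_sub_C_dvd_of_isRoot {R ι : Type*} [CommRing R] [IsDomain R] (s : Finset ι)
    (r : ι → R) (hr : Set.InjOn r s) {f : R[X]} (hf : ∀ i ∈ s, f.IsRoot (r i)) :
    ∏ i ∈ s, (X - C (r i)) ∣ f := by
  rcases eq_or_ne f 0 with rfl | hf₀
  · exact dvd_zero _
  have h := (Multiset.prod_X_sub_C_dvd_iff_le_roots hf₀ (s.val.map r)).2 <|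
    (Multiset.le_iff_subset (Multiset.Nodup.map_on (fun x hx y hy => hr hx hy) s.nodup)).2 <| by
      intro x hx
      obtain ⟨i, hi, rfl⟩ := Multiset.mem_map.1 hx
      exact (mem_roots hf₀).2 (hf i hi)
  rwa [Multiset.map_map] at h

section Polynomial

variable {S T : Type*} [CommRing S] [CommRing T] [Algebra S T]

/-- Evaluation `T[X] → T ⊗[S] T` at `1 ⊗ θ`. -/
noncomputable def evalRight (S : Type*) {T : Type*} [CommRing S] [CommRing T] [Algebra S T]
    (θ : T) : T[X] →ₐ[T] T ⊗[S] T :=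
  aeval ((1 : T) ⊗ₜ[S] θ)

/-- This turns the action of `T ⊗[S] T` on `T_σ` into evaluation of polynomials at `θ^σ`. -/
theorem twist_evalRight (σ : T ≃ₐ[S] T) (θ : T) (f : T[X]) :
    twist σ (evalRight S θ f) = f.eval (σ θ) := by
  induction f using Polynomial.induction_on' with
  | add f g hf hg => simp [hf, hg]
  | monomial n r =>
    simp [evalRight, aeval_monomial, Algebra.TensorProduct.algebraMap_apply, twist_tmul]

theorem evalRight_map (θ : T) (f : S[X]) :
    evalRight S θ (f.map (algebraMap S T)) = 1 ⊗ₜ[S] aeval θ f := by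
  rw [evalRight, aeval_map_algebraMap]
  exact (aeval_algHom_apply (Algebra.TensorProduct.includeRight : T →ₐ[S] T ⊗[S] T) θ f)

theorem evalRight_surjective {θ : T} (hθ : Algebra.adjoin S {θ} = ⊤) :
    Function.Surjective (evalRight S θ) := by
  intro x
  induction x using TensorProduct.induction_on with
  | zero => exact ⟨0, map_zero _⟩
  | add x y hx hy =>
    obtain ⟨f, rfl⟩ := hx
    obtain ⟨g, rfl⟩ := hy
    exact ⟨f + g, map_add _ _ _⟩
  | tmul x y =>
    have hy : y ∈ Algebra.adjoin S {θ} := hθ ▸ Algebra.mem_top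
    rw [Algebra.adjoin_singleton_eq_range_aeval] at hy
    obtain ⟨f, rfl⟩ := hy
    refine ⟨C x * f.map (algebraMap S T), ?_⟩
    rw [map_mul]
    erw [evalRight_map]
    simp [evalRight, Algebra.TensorProduct.algebraMap_apply]

end Polynomial

theorem isTorsionFree_of_isFractionRing (S T K L : Type*) [CommRing S] [CommRing T] [IsDomain S]
    [Algebra S T] [Field K] [Field L] [Algebra S K] [IsFractionRing S K] [Algebra T L]
    [Algebra K L] [Algebra S L] [IsScalarTower S K L] [IsScalarTower S T L] [IsDomain T] :
    Module.IsTorsionFree S T := by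
  rw [Module.isTorsionFree_iff_algebraMap_injective]
  have h : Function.Injective (algebraMap S L) := by
    rw [IsScalarTower.algebraMap_eq S K L]
    exact (algebraMap K L).injective.comp (IsFractionRing.injective S K)
  rw [IsScalarTower.algebraMap_eq S T L] at h
  exact Function.Injective.of_comp h

section Galois

universe v u w₁ w₂

variable (S : Type v) {T : Type u} (K : Type w₁) (L : Type w₂)
  [CommRing S]
  [CommRing T] [IsDomain T] [IsDiscreteValuationRing T]
  [Algebra S T] [Module.Finite S T] [Field K] [Field L]
  [Algebra S K] [IsFractionRing S K] [Algebra T L] [IsFractionRing T L]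
  [Algebra K L] [Algebra S L] [IsScalarTower S K L] [IsScalarTower S T L]
  [FiniteDimensional K L]

/-- An automorphism of `T` over `S` is determined by its value on the generator `θ`; hence the
conjugates of `θ` are pairwise distinct. -/
theorem galRestrict_apply_injective {θ : T} (hθ : Algebra.adjoin S {θ} = ⊤) :
    Function.Injective fun σ : L ≃ₐ[K] L => galRestrict S K L T σ θ := by
  intro σ τ h
  refine (galRestrict S K L T).injective (AlgEquiv.coe_toAlgHom_injective ?_)
  refine AlgHom.ext_of_adjoin_eq_top hθ ?_
  simpa [Set.EqOn] using h

open Classical in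
/-- The product of `X - θ^σ` over all `σ ≠ 1`. -/
noncomputable def cofactor (θ : T) : T[X] :=
  ∏ σ ∈ (Finset.univ : Finset (L ≃ₐ[K] L)).erase 1, (X - C (galRestrict S K L T σ θ))

theorem X_sub_C_mul_cofactor (θ : T) : (X - C θ) * cofactor S K L θ =
    ∏ σ : L ≃ₐ[K] L, (X - C (galRestrict S K L T σ θ)) := by
  classical
  rw [cofactor, ← Finset.mul_prod_erase _ _ (Finset.mem_univ 1), map_one, AlgEquiv.one_apply]

theorem cofactor_ne_zero (θ : T) : cofactor S K L θ ≠ 0 :=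
  (monic_prod_X_sub_C _ _).ne_zero

theorem eval_cofactor_of_ne {θ : T} {σ : L ≃ₐ[K] L} (hσ : σ ≠ 1) :
    (cofactor S K L θ).eval (galRestrict S K L T σ θ) = 0 := by
  classical
  rw [cofactor, eval_prod]
  exact Finset.prod_eq_zero (Finset.mem_erase.2 ⟨hσ, Finset.mem_univ _⟩) (by simp)

theorem galRestrict_sub_ne_zero {θ : T} (hθ : Algebra.adjoin S {θ} = ⊤) {σ : L ≃ₐ[K] L}
    (hσ : σ ≠ 1) : galRestrict S K L T σ θ - θ ≠ 0 := fun h =>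
  hσ <| galRestrict_apply_injective S K L hθ <| by
    simpa [sub_eq_zero] using h

theorem associated_eval_cofactor {t θ : T} (ht : IsLocalRing.maximalIdeal T = Ideal.span {t})
    (hθ : Algebra.adjoin S {θ} = ⊤) :
    Associated ((cofactor S K L θ).eval θ) (t ^ phi S K L t θ) := by
  classical
  have hphi : phi S K L t θ = ∑ σ ∈ (Finset.univ : Finset (L ≃ₐ[K] L)).erase 1,
      multiplicity t (θ - galRestrict S K L T σ θ) := by
    rw [phi, finsum_eq_sum_of_fintype, ← Finset.filter_ne', Finset.sum_filter]
    refine Finset.sum_congr rfl fun σ _ => ?_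
    rw [finsum_eq_if]
  rw [hphi, cofactor, eval_prod, ← Finset.prod_pow_eq_pow_sum]
  refine Associated.prod _ _ _ fun σ hσ => ?_
  have hne : θ - galRestrict S K L T σ θ ≠ 0 := fun h =>
    galRestrict_sub_ne_zero S K L hθ (Finset.ne_of_mem_erase hσ) (by rw [← neg_sub, h, neg_zero])
  have htirr := (IsDiscreteValuationRing.irreducible_iff_uniformizer t).2 ht
  have hfin : FiniteMultiplicity t (θ - galRestrict S K L T σ θ) :=
    FiniteMultiplicity.of_not_isUnit htirr.not_isUnit hne
  obtain ⟨c, hc, hndvd⟩ := hfin.exists_eq_pow_mul_and_not_dvd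
  -- A nonunit would lie in the maximal ideal `(t)`, contrary to the choice of `c` prime to `t`.
  have hcu : IsUnit c := by
    by_contra hcu
    refine hndvd (Ideal.mem_span_singleton.1 (ht ▸ ?_))
    exact (IsLocalRing.mem_maximalIdeal c).2 hcu
  simp only [eval_sub, eval_X, eval_C]
  conv_lhs => rw [hc]
  exact associated_mul_isUnit_left_iff hcu |>.2 (Associated.refl _)

variable [IsDomain S] [IsDiscreteValuationRing S] [IsGalois K L]

/-- The distinct conjugates are roots, so the product divides. Equality of these monic polynomials
follows by degree: as `S` is integrally closed, the minimal polynomial over `S` has the same degree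
as over `K`, at most `[L : K]`, the order of the Galois group. -/
theorem map_minpoly_eq_prod {θ : T} (hθ : Algebra.adjoin S {θ} = ⊤) :
    (minpoly S θ).map (algebraMap S T) = ∏ σ : L ≃ₐ[K] L, (X - C (galRestrict S K L T σ θ)) := by
  have hint : IsIntegral S θ := Algebra.IsIntegral.isIntegral θ
  have := isTorsionFree_of_isFractionRing S T K L
  have hmonic : ((minpoly S θ).map (algebraMap S T)).Monic := (minpoly.monic hint).map _
  refine eq_of_monic_of_dvd_of_natDegree_le (monic_prod_X_sub_C _ _) hmonic ?_ ?_
  · refine prod_X_sub_C_dvd_of_isRoot _ _ (galRestrict_apply_injective S K L hθ).injOn fun σ _ => ?_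
    rw [IsRoot, eval_map_algebraMap]
    exact (aeval_algHom_apply (galRestrict S K L T σ : T →ₐ[S] T) θ _).trans (by simp)
  · rw [natDegree_prod_of_monic _ _ fun _ _ => monic_X_sub_C _, (minpoly.monic hint).natDegree_map]
    have h := minpoly.natDegree_le (A := K) (algebraMap T L θ)
    rw [minpoly.isIntegrallyClosed_eq_field_fractions K L hint,
      (minpoly.monic hint).natDegree_map] at h
    simpa [← IsGalois.card_aut_eq_finrank, Nat.card_eq_fintype_card] using h

/-- `T ⊗[S] T` is the quotient of `T[X]` by the polynomial with roots the conjugates of `θ`. -/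
theorem evalRight_eq_zero_iff {θ : T} (hθ : Algebra.adjoin S {θ} = ⊤) (f : T[X]) :
    evalRight S θ f = 0 ↔ ∏ σ : L ≃ₐ[K] L, (X - C (galRestrict S K L T σ θ)) ∣ f := by
  refine ⟨fun h => ?_, fun ⟨g, hg⟩ => ?_⟩
  -- Applying the twist by each `σ` shows that `f` vanishes at every conjugate of `θ`.
  · refine prod_X_sub_C_dvd_of_isRoot _ _ (galRestrict_apply_injective S K L hθ).injOn fun σ _ => ?_
    rw [IsRoot, ← twist_evalRight, h, map_zero]
  · rw [hg, ← map_minpoly_eq_prod S K L hθ, map_mul]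
    erw [evalRight_map]
    rw [minpoly.aeval, TensorProduct.tmul_zero, zero_mul]

end Galois
end TwistedHochschild

/-! ### Twisted bimodules and the resolution of the untwisted one. -/

namespace TwistedHochschild
open Polynomial

section Twisted

universe v u

variable {S : Type v} {T : Type u} [CommRing S] [CommRing T] [Algebra S T] (σ : T ≃ₐ[S] T)

/-- The map of bimodules `T ⊗[S] T → T_σ`, `x ⊗ y ↦ x * σ y`. -/
noncomputable def toTwisted : ModuleCat.of (T ⊗[S] T) (T ⊗[S] T) ⟶ twisted σ T :=
  ModuleCat.ofHom (Y := twisted σ T)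
    { toFun := twist σ
      map_add' := map_add _
      map_smul' := map_mul (twist σ) }

/-- The quotient map from `T_σ` onto `T ⧸ (d)`. -/
noncomputable def twistedMk (d : T) : twisted σ T ⟶ twisted σ (T ⧸ Ideal.span {d}) :=
  (ModuleCat.restrictScalars (twist σ : T ⊗[S] T →+* T)).map
    (ModuleCat.ofHom (Submodule.mkQ (Ideal.span {d})))

theorem twistedMk_surjective (d : T) : Function.Surjective (twistedMk σ d) :=
  Submodule.mkQ_surjective (Ideal.span {d})

theorem twistedMk_eq_zero_iff {d : T} {r : T ⊗[S] T} (h : Associated (twist σ r) d)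
    (x : twisted σ T) : twistedMk σ d x = 0 ↔ ∃ y : twisted σ T, r • y = x := by
  refine (Submodule.Quotient.mk_eq_zero (Ideal.span {d}) (x := (show T from x))).trans ?_
  rw [Ideal.mem_span_singleton, ← h.dvd_iff_dvd_left]
  exact ⟨fun ⟨y, hy⟩ => ⟨y, hy.symm⟩, fun ⟨y, hy⟩ => ⟨y, hy.symm⟩⟩

theorem eq_zero_of_smul_twisted_eq_zero [IsDomain T] {r : T ⊗[S] T} (h : twist σ r ≠ 0)
    (x : twisted σ T) (hx : r • x = 0) : x = 0 :=
  (mul_eq_zero.1 (show twist σ r * (show T from x) = 0 from hx)).resolve_left h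

theorem smul_twisted_eq_zero {r : T ⊗[S] T} (h : twist σ r = 0) (x : twisted σ T) : r • x = 0 :=
  show twist σ r * (show T from x) = 0 by rw [h, zero_mul]

end Twisted

section Galois

universe v u w₁ w₂

variable (S : Type v) {T : Type u} (K : Type w₁) (L : Type w₂)
  [CommRing S] [IsDomain S] [IsDiscreteValuationRing S]
  [CommRing T] [IsDomain T] [IsDiscreteValuationRing T]
  [Algebra S T] [Module.Finite S T] [Field K] [Field L]
  [Algebra S K] [IsFractionRing S K] [Algebra T L] [IsFractionRing T L]
  [Algebra K L] [Algebra S L] [IsScalarTower S K L] [IsScalarTower S T L]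
  [FiniteDimensional K L] [IsGalois K L]

/-- The presentation of the untwisted bimodule `T` over `T ⊗[S] T` when `T = S[θ]`. -/
noncomputable def twistedPresentation {θ : T} (hθ : Algebra.adjoin S {θ} = ⊤) :
    PeriodicPresentation (twisted (AlgEquiv.refl : T ≃ₐ[S] T) T)
      (evalRight S θ (X - C θ)) (evalRight S θ (cofactor S K L θ)) where
  map := toTwisted AlgEquiv.refl
  surjective := fun (x : T) => ⟨x ⊗ₜ[S] (1 : T), (twist_tmul AlgEquiv.refl x 1).trans (by simp)⟩
  map_eq_zero_iff x := by
    obtain ⟨f, rfl⟩ := evalRight_surjective hθ x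
    change twist AlgEquiv.refl (evalRight S θ f) = 0 ↔ _
    rw [twist_evalRight]
    refine ⟨fun h => ?_, fun ⟨y, hy⟩ => ?_⟩
    · obtain ⟨g, rfl⟩ := dvd_iff_isRoot.2 h
      exact ⟨evalRight S θ g, map_mul _ _ _⟩
    · rw [← twist_evalRight, hy, map_mul, twist_evalRight]
      simp
  mul_eq_zero := by
    rw [← map_mul, evalRight_eq_zero_iff S K L hθ, X_sub_C_mul_cofactor]
  exists_of_mul_left x hx := by
    obtain ⟨f, rfl⟩ := evalRight_surjective hθ x
    rw [← map_mul, evalRight_eq_zero_iff S K L hθ, ← X_sub_C_mul_cofactor] at hx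
    -- In the domain `T[X]`, the factor `X - θ` cancels from `(X - θ) g ∣ (X - θ) f`.
    obtain ⟨g, rfl⟩ := (mul_dvd_mul_iff_left (X_sub_C_ne_zero θ)).1 hx
    exact ⟨evalRight S θ g, map_mul _ _ _⟩
  exists_of_mul_right x hx := by
    obtain ⟨f, rfl⟩ := evalRight_surjective hθ x
    rw [← map_mul, evalRight_eq_zero_iff S K L hθ, ← X_sub_C_mul_cofactor, mul_comm] at hx
    obtain ⟨g, rfl⟩ := (mul_dvd_mul_iff_left (cofactor_ne_zero S K L θ)).1 hx
    exact ⟨evalRight S θ g, map_mul _ _ _⟩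

end Galois
end TwistedHochschild

/-! ### Reading off homology and cohomology. -/

open TwistedHochschild
theorem mainTheorem6
    {S T K L : Type*}
    [CommRing S] [IsDomain S] [IsDiscreteValuationRing S]
    [CommRing T] [IsDomain T] [IsDiscreteValuationRing T]
    [Algebra S T] [Module.Finite S T]
    [Field K] [Field L] [Algebra S K] [IsFractionRing S K] [Algebra T L] [IsFractionRing T L]
    [Algebra K L] [Algebra S L] [IsScalarTower S K L] [IsScalarTower S T L]
    [FiniteDimensional K L] [IsGalois K L]
    (t : T) (ht : IsLocalRing.maximalIdeal T = Ideal.span {t})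
    (θ : T) (hθ : Algebra.adjoin S {θ} = ⊤) :
    (Nonempty (hochschildHomology S T
        (twisted (galRestrict S K L T 1) T) 0 ≅
          twisted (galRestrict S K L T 1) T) ∧
      (∀ j : ℕ, Odd j → Nonempty (hochschildHomology S T
        (twisted (galRestrict S K L T 1) T) j ≅
          twisted (galRestrict S K L T 1)
            (T ⧸ Ideal.span {t ^ phi S K L t θ}))) ∧
      (∀ j : ℕ, Even j → 2 ≤ j → Limits.IsZero (hochschildHomology S T
        (twisted (galRestrict S K L T 1) T) j))) ∧
    (∀ σ : L ≃ₐ[K] L, σ ≠ 1 →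
      (∀ j : ℕ, Odd j → Limits.IsZero (hochschildHomology S T
        (twisted (galRestrict S K L T σ) T) j)) ∧
      (∀ j : ℕ, Even j → Nonempty (hochschildHomology S T
        (twisted (galRestrict S K L T σ) T) j ≅
          twisted (galRestrict S K L T σ)
            (T ⧸ Ideal.span {galRestrict S K L T σ θ - θ})))) ∧
    (Nonempty (hochschildCohomology S T
        (twisted (galRestrict S K L T 1) T) 0 ≅
          twisted (galRestrict S K L T 1) T) ∧
      (∀ j : ℕ, Odd j → Limits.IsZero (hochschildCohomology S T
        (twisted (galRestrict S K L T 1) T) j)) ∧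
      (∀ j : ℕ, Even j → 2 ≤ j → Nonempty (hochschildCohomology S T
        (twisted (galRestrict S K L T 1) T) j ≅
          twisted (galRestrict S K L T 1)
            (T ⧸ Ideal.span {t ^ phi S K L t θ})))) ∧
    (∀ σ : L ≃ₐ[K] L, σ ≠ 1 →
      (∀ j : ℕ, Odd j → Nonempty (hochschildCohomology S T
        (twisted (galRestrict S K L T σ) T) j ≅
          twisted (galRestrict S K L T σ)
            (T ⧸ Ideal.span {galRestrict S K L T σ θ - θ}))) ∧
      (∀ j : ℕ, Even j → Limits.IsZero (hochschildCohomology S T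
        (twisted (galRestrict S K L T σ) T) j))) := by
  have p := twistedPresentation S K L hθ
  have ha (σ : L ≃ₐ[K] L) : twist (galRestrict S K L T σ) (evalRight S θ (Polynomial.X - Polynomial.C θ)) =
      galRestrict S K L T σ θ - θ := by
    rw [twist_evalRight]
    simp
  have ha₁ : twist (galRestrict S K L T 1) (evalRight S θ (Polynomial.X - Polynomial.C θ)) = 0 := by
    rw [ha, map_one, AlgEquiv.one_apply, sub_self]
  have hb₁ : twist (galRestrict S K L T 1) (evalRight S θ (cofactor S K L θ)) =
      (cofactor S K L θ).eval θ := by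
    rw [twist_evalRight, map_one, AlgEquiv.one_apply]
  have hassoc := associated_eval_cofactor S K L ht hθ
  have hb₀ : (cofactor S K L θ).eval θ ≠ 0 := hassoc.ne_zero_iff.2 <| pow_ne_zero _ <|
    ((IsDiscreteValuationRing.irreducible_iff_uniformizer t).2 ht).ne_zero
  rw [← hb₁] at hassoc hb₀
  refine ⟨⟨?_, fun j hj => ?_, fun j hj hj₂ => ?_⟩, fun σ hσ => ?_,
    ⟨?_, fun j hj => ?_, fun j hj hj₂ => ?_⟩, fun σ hσ => ?_⟩
  -- The incoming differential is `a`, which acts by zero, so the cokernel is everything and the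
  -- quotient map is the identity.
  · refine p.nonempty_tor_iso_of_even (𝟙 _) Function.surjective_id Even.zero (absurd rfl) fun x => ?_
    exact ⟨fun hx => ⟨0, (smul_twisted_eq_zero _ ha₁ 0).trans hx.symm⟩,
      fun ⟨y, hy⟩ => hy.symm.trans (smul_twisted_eq_zero _ ha₁ y)⟩
  · exact p.nonempty_tor_iso_of_odd _ (twistedMk_surjective _ _) (smul_twisted_eq_zero _ ha₁)
      (twistedMk_eq_zero_iff _ hassoc) hj
  · exact p.isZero_tor_of_even (eq_zero_of_smul_twisted_eq_zero _ hb₀) hj (by lia)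
  -- For `σ ≠ 1` the cofactor has `θ^σ` as a root: now `b` acts by zero and `a` injectively, the
  -- reverse of the untwisted case.
  · have hb : twist (galRestrict S K L T σ) (evalRight S θ (cofactor S K L θ)) = 0 := by
      rw [twist_evalRight, eval_cofactor_of_ne S K L hσ]
    have ha₀ := galRestrict_sub_ne_zero S K L hθ hσ
    exact ⟨fun j hj => p.isZero_tor_of_odd (eq_zero_of_smul_twisted_eq_zero _ (ha σ ▸ ha₀)) hj,
      fun j hj => p.nonempty_tor_iso_of_even _ (twistedMk_surjective _ _) hj
        (fun _ => smul_twisted_eq_zero _ hb) (twistedMk_eq_zero_iff _ (.of_eq (ha σ)))⟩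
  · exact p.nonempty_ext_zero_iso (smul_twisted_eq_zero _ ha₁)
  · exact p.isZero_ext_of_odd (eq_zero_of_smul_twisted_eq_zero _ hb₀) hj
  · exact p.nonempty_ext_iso_of_even _ (twistedMk_surjective _ _) (smul_twisted_eq_zero _ ha₁)
      (twistedMk_eq_zero_iff _ hassoc) hj (by lia)
  · have hb : twist (galRestrict S K L T σ) (evalRight S θ (cofactor S K L θ)) = 0 := by
      rw [twist_evalRight, eval_cofactor_of_ne S K L hσ]
    have ha₀ := galRestrict_sub_ne_zero S K L hθ hσ
    exact ⟨fun j hj => p.nonempty_ext_iso_of_odd _ (twistedMk_surjective _ _)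
        (smul_twisted_eq_zero _ hb) (twistedMk_eq_zero_iff _ (.of_eq (ha σ))) hj,
      fun j hj => p.isZero_ext_of_even (eq_zero_of_smul_twisted_eq_zero _ (ha σ ▸ ha₀)) hj⟩
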